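/- Let $X\neq\{0\}$ be a real Hausdorff locally convex space with topology $\tau$, $X^*$ its topological dual with the weak-star topology $\omega^*$, and $c(x,x^*)=\langle x,x^*\rangle:=x^*(x)$ on $X\times X^*$. For $T:X\rightrightarrows X^*$ put $\operatorname{Graph}T=\{(x,x^*): x^*\in Tx\}$ and $D(T)=\{x: Tx\ne\emptyset\}$; for $V\subset X$ let $T|_V$ be the operator with graph $\operatorname{Graph}T\cap(V\times X^*)$. Let $$\varphi_T(x,x^*)=\sup\{\langle x,u^*\rangle+\langle u,x^*\rangle-\langle u,u^*\rangle : (u,u^*)\in\operatorname{Graph}T\}\qquad(\sup\emptyset=-\infty),$$ and let $\psi_T$ be the $\tau\times\omega^*$-lower semicontinuous hull of the convex hull of the function equal to $c$ on $\operatorname{Graph}T$ and to $+\infty$ elsewhere. For $f,g$ on $X\times X^*$, $[f\le g]=\{z: f(z)\le g(z)\}$, and similarly $[f=g]$, $[f\ge g]$. $T$ is monotone if $\langle x-y,x^*-y^*\rangle\ge0$ for all $(x,x^*),(y,y^*)\in\operatorname{Graph}T$. For $V\subset X$: - $V$ identifies $T$ if $[\varphi_{T|_V}\le c]\cap (V\times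 X^*)\subset\operatorname{Graph}T$; - $V$ locates $T$ if $[\varphi_{T|_V}\le c]\cap (V\times X^*)\subset D(T)\times X^*$; - $T$ is $V$-NI if $V\times X^*\subset[\varphi_{T|_V}\ge c]$. $T$ is identifiable (locatable, locally-NI) if $V$ identifies $T$ ($V$ locates $T$, $T$ is $V$-NI) for every open convex $V\subset X$ with $V\cap D(T)\ne\emptyset$. $T$ is $V$-representable if $V\cap D(T)\neq\emptyset$ and there is a proper convex $\tau\times\omega^*$-lower semicontinuous function $h:X\times X^*\to\overline{\mathbb R}$ with $h\ge c$ and $[h=c]\cap(V\times X^*)=\operatorname{Graph}(T|_V)$; $T$ is representable if it is $X$-representable, and low-representable if for every $(x,x^*)\in[\psi_T=c]$ there is a neighbourhood $V$ of $x$ such that $T$ is $V$-representable. For $C\subset X$ and $x\in C$ let $N_C(x)=\{x^*:\langle u-x,x^*\rangle\le0\ \forall u\in C\}$, and $N_C(x)=\emptyset$ for $x\notin C$; $(T+N_C)(x)=Tx+N_C(x)$. **Theorem.** Let $T:X\rightrightarrows X^*$, and let $\mathcal C_T$ be the family of all closed convex $C\subset X$ with $D(T)\cap\operatorname{int}C\neq\emptyset$.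 (i) If $T$ is $C$-NI for every $C\in\mathcal C_T$, then $T$ is locally-NI. Conversely, if $T$ is locally-NI, then $T$ is $C$-NI for every $C\in\mathcal C_T$ for which $T|_{\operatorname{int}C}$ is monotone. In particular, if $T$ is monotone, then $T$ is locally-NI iff $T$ is $C$-NI for every $C\in\mathcal C_T$. (ii) $T$ is locatable iff $[\varphi_{T|_C}\le c]\cap(\operatorname{int}C\times X^*)\subset D(T)\times X^*$ for every $C\in\mathcal C_T$. In particular, if every $C\in\mathcal C_T$ locates $T$, then $T$ is locatable. (iii) $T$ is identifiable iff $[\varphi_{T|_C}\le c]\cap(\operatorname{int}C\times X^*)\subset\operatorname{Graph}T$ for every $C\in\mathcal C_T$. In particular, if every $C\in\mathcal C_T$ identifies $T+N_C$, then $T$ is identifiable. (iv) The following are equivalent: (a) $T$ is monotone with non-empty graph, and identifiable; (b) $T$ is representable and every $C\in\mathcal C_T$ locates $T$; (c) $T$ is monotone with non-empty graph, low-representable, and $C$-NI for every $C\in\mathcal C_T$. -/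

import Mathlib

/-! Multivalued operators `T : X ⇉ X*` on a real locally convex space `X`. The dual `X*` is
`WeakDual ℝ X`, so `X × WeakDual ℝ X` carries the product `τ × ω*` of the given topology and the
weak-star topology. -/

namespace LCSOperator

section Functions

variable {E : Type*}

/-- The epigraph of an extended real valued function, a subset of `E × ℝ`. -/
def epi (f : E → EReal) : Set (E × ℝ) := {p | f p.1 ≤ (p.2 : EReal)}

/-- `f` is proper: it is somewhere `< +∞` and nowhere `-∞`. -/
def IsProper (f : E → EReal) : Prop := (∃ x, f x < ⊤) ∧ ∀ x, f x ≠ ⊥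

/-- `f` is convex, i.e. its epigraph is convex. -/
def IsConvexFun [AddCommGroup E] [Module ℝ E] (f : E → EReal) : Prop := Convex ℝ (epi f)

/-- The convex hull of `f`: `(conv f)(x) = inf {t | (x, t) ∈ conv (epi f)}`. -/
noncomputable def convFun [AddCommGroup E] [Module ℝ E] (f : E → EReal) (x : E) : EReal :=
  ⨅ (t : ℝ) (_ : (x, t) ∈ convexHull ℝ (epi f)), (t : EReal)

/-- The lower semicontinuous hull of `f`, the function whose epigraph is the closure of `epi f`. -/
noncomputable def lscFun [TopologicalSpace E] (f : E → EReal) (x : E) : EReal :=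
  ⨅ (t : ℝ) (_ : (x, t) ∈ closure (epi f)), (t : EReal)

end Functions

variable {X : Type*} [AddCommGroup X] [Module ℝ X] [TopologicalSpace X]

/-- The graph of `T`. -/
def graph (T : X → Set (WeakDual ℝ X)) : Set (X × WeakDual ℝ X) := {z | z.2 ∈ T z.1}

/-- The domain `D(T)`. -/
def domain (T : X → Set (WeakDual ℝ X)) : Set X := {x | (T x).Nonempty}

/-- The restriction `T|_V`, with graph `Graph T ∩ (V × X*)`. -/
def restrict (T : X → Set (WeakDual ℝ X)) (V : Set X) : X → Set (WeakDual ℝ X) :=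
  fun x => {y | x ∈ V ∧ y ∈ T x}

/-- The coupling `c(x, x*) = ⟨x, x*⟩`. -/
noncomputable def coupling (z : X × WeakDual ℝ X) : ℝ := z.2 z.1

/-- Monotonicity of `T` (the void operator included). -/
def IsMonotone (T : X → Set (WeakDual ℝ X)) : Prop :=
  ∀ z ∈ graph T, ∀ w ∈ graph T, 0 ≤ (z.2 - w.2) (z.1 - w.1)

/-- The class of non-void monotone operators. -/
def IsNonvoidMonotone (T : X → Set (WeakDual ℝ X)) : Prop := (graph T).Nonempty ∧ IsMonotone T

open Classical in
/-- `c_T = c + ι_{Graph T}`. -/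
noncomputable def couplingOn (T : X → Set (WeakDual ℝ X)) (z : X × WeakDual ℝ X) : EReal :=
  if z ∈ graph T then (coupling z : EReal) else ⊤

/-- The Fitzpatrick function
`φ_T(x, x*) = sup {⟨x, u*⟩ + ⟨u, x*⟩ - ⟨u, u*⟩ | (u, u*) ∈ Graph T}`, with `sup ∅ = -∞`. -/
noncomputable def phi (T : X → Set (WeakDual ℝ X)) (z : X × WeakDual ℝ X) : EReal :=
  ⨆ w ∈ graph T, ((w.2 z.1 + z.2 w.1 - w.2 w.1 : ℝ) : EReal)

/-- `ψ_T = cl_{τ × ω*} (conv c_T)`. -/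
noncomputable def psi (T : X → Set (WeakDual ℝ X)) : X × WeakDual ℝ X → EReal :=
  lscFun (convFun (couplingOn T))

/-- The set `[φ_T ≤ c]` of all `z` that are monotonically related to `T`. -/
def monRelated (T : X → Set (WeakDual ℝ X)) : Set (X × WeakDual ℝ X) :=
  {z | phi T z ≤ (coupling z : EReal)}

/-- `V` identifies `T`: `[φ_{T|_V} ≤ c] ∩ V × X* ⊆ Graph T`. -/
def Identifies (V : Set X) (T : X → Set (WeakDual ℝ X)) : Prop :=
  monRelated (restrict T V) ∩ V ×ˢ Set.univ ⊆ graph T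

/-- `V` locates `T`: `[φ_{T|_V} ≤ c] ∩ V × X* ⊆ D(T) × X*`. -/
def Locates (V : Set X) (T : X → Set (WeakDual ℝ X)) : Prop :=
  monRelated (restrict T V) ∩ V ×ˢ Set.univ ⊆ domain T ×ˢ Set.univ

/-- `T` is `V`-NI: `V × X* ⊆ [φ_{T|_V} ≥ c]`. -/
def IsNIOn (T : X → Set (WeakDual ℝ X)) (V : Set X) : Prop :=
  V ×ˢ Set.univ ⊆ {z | (coupling z : EReal) ≤ phi (restrict T V) z}

/-- `T` is identified by every open convex `V` that meets `D(T)`. -/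
def IsIdentifiable (T : X → Set (WeakDual ℝ X)) : Prop :=
  ∀ V : Set X, IsOpen V → Convex ℝ V → (V ∩ domain T).Nonempty → Identifies V T

/-- `T` is located by every open convex `V` that meets `D(T)`. -/
def IsLocatable (T : X → Set (WeakDual ℝ X)) : Prop :=
  ∀ V : Set X, IsOpen V → Convex ℝ V → (V ∩ domain T).Nonempty → Locates V T

/-- `T` is `V`-NI for every open convex `V` that meets `D(T)`. -/
def IsLocallyNI (T : X → Set (WeakDual ℝ X)) : Prop :=
  ∀ V : Set X, IsOpen V → Convex ℝ V → (V ∩ domain T).Nonempty → IsNIOn T V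

/-- The class of proper convex `τ × ω*`-lower semicontinuous functions `h ≥ c` on `X × X*`. -/
def IsRepresentative (h : X × WeakDual ℝ X → EReal) : Prop :=
  IsProper h ∧ IsConvexFun h ∧ LowerSemicontinuous h ∧ ∀ z, (coupling z : EReal) ≤ h z

/-- `T` is `V`-representable: `V` meets `D(T)` and `[h = c] ∩ V × X* = Graph (T|_V)` for some
`h` of the preceding class. -/
def IsRepresentableOn (T : X → Set (WeakDual ℝ X)) (V : Set X) : Prop :=
  (V ∩ domain T).Nonempty ∧ ∃ h : X × WeakDual ℝ X → EReal, IsRepresentative h ∧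
    {z | h z = (coupling z : EReal)} ∩ V ×ˢ Set.univ = graph (restrict T V)

/-- `T` is representable, i.e. `X`-representable. -/
def IsRepresentable (T : X → Set (WeakDual ℝ X)) : Prop := IsRepresentableOn T Set.univ

/-- `T` is low-representable: each `(x, x*) ∈ [ψ_T = c]` has a neighbourhood `V` of `x` on which
`T` is `V`-representable. -/
def IsLowRepresentable (T : X → Set (WeakDual ℝ X)) : Prop :=
  ∀ z : X × WeakDual ℝ X, psi T z = (coupling z : EReal) →
    ∃ V ∈ nhds z.1, IsRepresentableOn T V

/-- The normal cone `N_C = ∂ι_C`; it is empty outside `C`. -/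
def normalCone (C : Set X) : X → Set (WeakDual ℝ X) :=
  fun x => {y | x ∈ C ∧ ∀ u ∈ C, y (u - x) ≤ 0}

/-- The pointwise sum `(A + B)(x) = A x + B x` of two operators. -/
def opAdd (A B : X → Set (WeakDual ℝ X)) : X → Set (WeakDual ℝ X) :=
  fun x => {y | ∃ a ∈ A x, ∃ b ∈ B x, y = a + b}

/-- `C` is a closed convex set with `D(T) ∩ int C ≠ ∅`. -/
def IsTestSet (T : X → Set (WeakDual ℝ X)) (C : Set X) : Prop :=
  IsClosed C ∧ Convex ℝ C ∧ (domain T ∩ interior C).Nonempty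

end LCSOperator

/-! Everything rests on a first-order argument. If `φ_{T|_V} ≥ c` over `V` and `z` over `V`
satisfies `φ_{T|_V}(z) ≤ c(z)`, then along segments issued from `z` that stay over `V` the convex
`φ_{T|_V}` lies above the tangent of `c` at `z` (`IsNIOn.le_of_mem_monRelated`). When `V` is open
every direction is allowed, so the conjugate of `φ_{T|_V}` is at most `c` at `z`. By Hahn–Banach
every representative `h` of `T` then has `h(z) = c(z)`, so `z` is in the graph
(`IsRepresentative.eq_coupling`).

For closed `C`, a boundary point allows only directions into `C`; `exists_subgradient_add_normal`
absorbs the constraint into a functional `n`, and `(x, x* - n)` is monotonically related to all of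
`T`. In the low-representable case, representatives exist only near points of `[ψ_T = c]`, so one
also needs `x` in the closure of `D(T)` (`IsLocallyNI.mem_closure_domain`). Parts (i)–(iii) compare
open convex sets with closed convex subsets of them. -/

namespace LCSOperator

open Filter Topology Set

open scoped Pointwise

/-! ### Separation, and closed convex subsets of open convex sets. -/

section Separation

variable {E : Type*} [AddCommGroup E] [Module ℝ E] [TopologicalSpace E]
  [IsTopologicalAddGroup E] [ContinuousSMul ℝ E] [LocallyConvexSpace ℝ E]

/-- A point below a closed convex set which is not vertical over `e` lies below a continuous affine
minorant of this set. -/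
theorem exists_affine_minorant {A : Set (E × ℝ)} (hA : Convex ℝ A) (hA' : IsClosed A)
    {e : E} {t₀ t₁ : ℝ} (he : ∀ t, t₀ ≤ t → (e, t) ∈ A) (he' : (e, t₁) ∉ A)
    {z : E} {a : ℝ} (hz : (z, a) ∉ A) :
    ∃ (l : E →L[ℝ] ℝ) (r : ℝ), (∀ p ∈ A, l p.1 - r ≤ p.2) ∧ a < l z - r := by
  have sep : ∀ q : E × ℝ, q ∉ A → ∃ (l : E →L[ℝ] ℝ) (k u : ℝ), 0 ≤ k ∧
      (∀ p ∈ A, l p.1 - k * p.2 ≤ u) ∧ u < l q.1 - k * q.2 := by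
    intro q hq
    obtain ⟨F, u, h1, h2⟩ := geometric_hahn_banach_closed_point hA hA' hq
    have hF : ∀ p : E × ℝ, F p = F (p.1, 0) - (-F (0, 1)) * p.2 := by
      intro p
      have : p = (p.1, 0) + p.2 • ((0, 1) : E × ℝ) := by ext <;> simp
      conv_lhs => rw [this, map_add, map_smul]
      simp [mul_comm]
    refine ⟨F.comp (ContinuousLinearMap.inl ℝ E ℝ), -F (0, 1), u, ?_, ?_, ?_⟩
    · by_contra! hk
      set k := -F (0, 1)
      have h3 := h1 _ (he (max t₀ ((F (e, 0) - u) / k)) (le_max_left _ _))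
      rw [hF] at h3
      have h4 : k * max t₀ ((F (e, 0) - u) / k) ≤ k * ((F (e, 0) - u) / k) :=
        mul_le_mul_of_nonpos_left (le_max_right _ _) hk.le
      rw [mul_div_cancel₀ _ hk.ne] at h4
      simp only at h3
      linarith
    · intro p hp
      have := h1 p hp
      rw [hF] at this
      simpa using this.le
    · rw [hF] at h2
      simpa using h2
  obtain ⟨l, k, u, hk, h1, h2⟩ := sep _ hz
  obtain ⟨l', k', u', hk', h1', h2'⟩ := sep _ he'
  have hk'pos : 0 < k' := by
    refine lt_of_le_of_ne hk' ?_
    rintro rfl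
    have := h1' _ (he t₀ le_rfl)
    simp only at this h2'
    linarith
  simp only at h2 h2'
  -- The functional found at `z` may be vertical (`k = 0`). Adding a large multiple of it to the
  -- non-vertical one found over `e` keeps a minorant of `A` and lifts its value at `z` above `a`.
  obtain ⟨s, hs, hs'⟩ : ∃ s : ℝ, 0 ≤ s ∧ u' - (l' z - k' * a) < s * (l z - k * a - u) := by
    obtain ⟨n, hn⟩ := Archimedean.arch (u' - (l' z - k' * a) + 1) (sub_pos.2 h2)
    exact ⟨n, n.cast_nonneg, by rw [← nsmul_eq_mul]; linarith⟩
  have hK : 0 < k' + s * k := by positivity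
  refine ⟨(k' + s * k)⁻¹ • (l' + s • l), (k' + s * k)⁻¹ * (u' + s * u), ?_, ?_⟩
  · intro p hp
    have e1 := h1' p hp
    have e2 := mul_le_mul_of_nonneg_left (h1 p hp) hs
    have : ((k' + s * k)⁻¹ • (l' + s • l)) p.1 - (k' + s * k)⁻¹ * (u' + s * u)
        = (k' + s * k)⁻¹ * (l' p.1 + s * l p.1 - (u' + s * u)) := by simp; ring
    rw [this, inv_mul_le_iff₀ hK]
    linarith
  · have : ((k' + s * k)⁻¹ • (l' + s • l)) z - (k' + s * k)⁻¹ * (u' + s * u)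
        = (k' + s * k)⁻¹ * (l' z + s * l z - (u' + s * u)) := by simp; ring
    rw [this, lt_inv_mul_iff₀ hK]
    linarith

/-- Two points of an open convex set are interior to a closed convex subset of it. -/
theorem exists_isClosed_convex_subset {V : Set E} (hV : IsOpen V) (hVc : Convex ℝ V) {x v : E}
    (hx : x ∈ V) (hv : v ∈ V) :
    ∃ C ⊆ V, IsClosed C ∧ Convex ℝ C ∧ x ∈ interior C ∧ v ∈ interior C := by
  have hK : IsCompact (segment ℝ x v) := by
    rw [segment_eq_image_lineMap]
    exact isCompact_Icc.image AffineMap.lineMap_continuous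
  obtain ⟨U, hU, hKU⟩ := compact_open_separated_add_right hK hV (hVc.segment_subset hx hv)
  obtain ⟨U', hU', hU'c, hU's⟩ := exists_mem_nhds_isClosed_subset hU
  obtain ⟨W, ⟨hW0, hW, hWc⟩, hWU⟩ :=
    (LocallyConvexSpace.convex_open_basis_zero ℝ E).mem_iff.1 hU'
  have hint : ∀ y ∈ segment ℝ x v, y ∈ interior (segment ℝ x v + closure W) := by
    intro y hy
    refine mem_interior.2 ⟨y +ᵥ W, ?_, hW.vadd y, ⟨0, hW0, by simp⟩⟩
    rintro _ ⟨w, hw, rfl⟩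
    exact add_mem_add hy (subset_closure hw)
  refine ⟨segment ℝ x v + closure W, ?_, ?_, ?_, hint _ (left_mem_segment ℝ x v),
    hint _ (right_mem_segment ℝ x v)⟩
  · exact (add_subset_add_left ((closure_minimal hWU hU'c).trans hU's)).trans hKU
  · exact isClosed_closure.add_left_of_isCompact hK
  · exact (convex_segment x v).add hWc.closure

end Separation

/-! ### Fitzpatrick functions on segments; open sets versus test sets. -/

section Basic

variable {X : Type*} [AddCommGroup X] [Module ℝ X]

theorem eventually_segment_mem_of_convex {C : Set X} (hC : Convex ℝ C) {x y : X} (hx : x ∈ C) (hy : y ∈ C) :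
    ∀ᶠ t in 𝓝[>] (0 : ℝ), x + t • (y - x) ∈ C := by
  filter_upwards [Ioc_mem_nhdsGT (zero_lt_one' ℝ)] with t ht
  exact hC.add_smul_sub_mem hx hy ⟨ht.1.le, ht.2⟩

variable [TopologicalSpace X]

@[simp]
theorem weakDual_add_apply (y y' : WeakDual ℝ X) (x : X) : (y + y') x = y x + y' x := rfl

@[simp]
theorem weakDual_sub_apply (y y' : WeakDual ℝ X) (x : X) :
    (y - y') x = y x - y' x := rfl

@[simp]
theorem weakDual_smul_apply (t : ℝ) (y : WeakDual ℝ X) (x : X) : (t • y) x = t * y x := rfl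

variable {T S : X → Set (WeakDual ℝ X)} {V W C : Set X} {z w : X × WeakDual ℝ X}

theorem graph_restrict_mono (h : V ⊆ W) : graph (restrict T V) ⊆ graph (restrict T W) :=
  fun _ hz => ⟨h hz.1, hz.2⟩

theorem graph_restrict_subset : graph (restrict T V) ⊆ graph T := fun _ hz => hz.2

theorem restrict_univ : restrict T univ = T := by
  ext x y; simp [restrict]

theorem IsMonotone.mono (hT : IsMonotone T) (h : graph S ⊆ graph T) : IsMonotone S :=
  fun z hz w hw => hT z (h hz) w (h hw)

theorem phi_le_iff {r : ℝ} :
    phi T z ≤ r ↔ ∀ w ∈ graph T, w.2 z.1 + z.2 w.1 - w.2 w.1 ≤ r := by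
  simp only [phi, iSup_le_iff, EReal.coe_le_coe_iff]

theorem phi_mono (h : graph S ⊆ graph T) : phi S z ≤ phi T z :=
  biSup_mono fun _ hw => h hw

theorem mem_monRelated : z ∈ monRelated T ↔ phi T z ≤ (coupling z : EReal) := Iff.rfl

theorem mem_monRelated_iff :
    z ∈ monRelated T ↔ ∀ w ∈ graph T, w.2 z.1 + z.2 w.1 - w.2 w.1 ≤ z.2 z.1 := phi_le_iff

theorem monRelated_anti (h : graph S ⊆ graph T) : monRelated T ⊆ monRelated S :=
  fun _ hz => (phi_mono h).trans hz

theorem coupling_le_phi_of_mem (hz : z ∈ graph T) : (coupling z : EReal) ≤ phi T z := by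
  refine le_trans ?_ (le_iSup₂ (f := fun (w : X × WeakDual ℝ X) (_ : w ∈ graph T) =>
    ((w.2 z.1 + z.2 w.1 - w.2 w.1 : ℝ) : EReal)) z hz)
  simp [coupling]

theorem isNIOn_iff :
    IsNIOn T V ↔ ∀ z, z.1 ∈ V → ∀ r : ℝ, phi (restrict T V) z ≤ r → coupling z ≤ r := by
  constructor
  · intro h z hz r hr
    exact EReal.coe_le_coe_iff.1 (le_trans (h ⟨hz, mem_univ _⟩) hr)
  · rintro h z ⟨hz, -⟩
    by_contra hlt
    obtain ⟨r, h1, h2⟩ := EReal.lt_iff_exists_real_btwn.1 (not_le.1 hlt)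
    exact absurd (h z hz r h1.le) (not_le.2 (EReal.coe_lt_coe_iff.1 h2))

/-- If `φ < c` at `z`, then `z.1` has an image `y`, and the graph point `(z.1, y)` alone contributes
exactly `c(z)` to the supremum. -/
theorem Locates.isNIOn (h : Locates V T) : IsNIOn T V := by
  rintro z ⟨hz, -⟩
  by_contra hlt
  obtain ⟨y, hy⟩ := (h ⟨mem_monRelated.2 (not_le.1 hlt).le, hz, mem_univ _⟩).1
  refine hlt ?_
  refine le_trans ?_ (le_iSup₂ (f := fun (w : X × WeakDual ℝ X) (_ : w ∈ graph (restrict T V)) =>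
    ((w.2 z.1 + z.2 w.1 - w.2 w.1 : ℝ) : EReal)) (z.1, y) ⟨hz, hy⟩)
  simp [coupling]

theorem Identifies.locates (h : Identifies V T) : Locates V T :=
  fun z hz => ⟨⟨z.2, h hz⟩, mem_univ _⟩

theorem IsMonotone.graph_subset_monRelated (hT : IsMonotone T) : graph T ⊆ monRelated T := by
  intro z hz
  rw [mem_monRelated_iff]
  intro w hw
  have := hT z hz w hw
  simp only [weakDual_sub_apply, map_sub] at this
  linarith

theorem coupling_segment (t : ℝ) : coupling (z + t • (w - z)) =
    (1 - t) ^ 2 * coupling z + t * (1 - t) * (w.2 z.1 + z.2 w.1) + t ^ 2 * coupling w := by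
  simp [coupling]
  ring

theorem phi_segment {a b t : ℝ} (hz : phi T z ≤ a) (hw : phi T w ≤ b) (h0 : 0 ≤ t) (h1 : t ≤ 1) :
    phi T (z + t • (w - z)) ≤ ((1 - t) * a + t * b : ℝ) := by
  rw [phi_le_iff] at *
  intro v hv
  have e1 := mul_le_mul_of_nonneg_left (hz v hv) (sub_nonneg.2 h1)
  have e2 := mul_le_mul_of_nonneg_left (hw v hv) h0
  simp
  linarith

theorem IsNIOn.eventually_coupling_segment_le (hNI : IsNIOn T C) {a b : ℝ}
    (hz : phi (restrict T C) z ≤ a) (hw : phi (restrict T C) w ≤ b)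
    (h : ∀ᶠ t in 𝓝[>] (0 : ℝ), z.1 + t • (w.1 - z.1) ∈ C) :
    ∀ᶠ t in 𝓝[>] (0 : ℝ), (1 - t) ^ 2 * coupling z + t * (1 - t) * (w.2 z.1 + z.2 w.1)
      + t ^ 2 * coupling w ≤ (1 - t) * a + t * b := by
  filter_upwards [h, Ioc_mem_nhdsGT (zero_lt_one' ℝ)] with t ht ht'
  rw [← coupling_segment]
  exact isNIOn_iff.1 hNI (z + t • (w - z)) ht _ (phi_segment hz hw ht'.1.le ht'.2)

/-- Let `t → 0` along the segment. The point `z` itself need not lie over `C`, which lets the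
inequality pass from an interior to the boundary. -/
theorem IsNIOn.coupling_le_of_eventually (hNI : IsNIOn T C) {a b : ℝ}
    (hz : phi (restrict T C) z ≤ a) (hw : phi (restrict T C) w ≤ b)
    (h : ∀ᶠ t in 𝓝[>] (0 : ℝ), z.1 + t • (w.1 - z.1) ∈ C) : coupling z ≤ a := by
  refine le_of_tendsto_of_tendsto ?_ ?_ (hNI.eventually_coupling_segment_le hz hw h)
  · refine tendsto_nhdsWithin_of_tendsto_nhds (Continuous.tendsto' (by fun_prop) _ _ (by simp))
  · refine tendsto_nhdsWithin_of_tendsto_nhds (Continuous.tendsto' (by fun_prop) _ _ (by simp))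

/-- Where `φ ≥ c`, the convex function `φ` lies above the differential of `c` at a point of
contact. -/
theorem IsNIOn.le_of_mem_monRelated (hNI : IsNIOn T C) {r : ℝ}
    (hz : z ∈ monRelated (restrict T C)) (hw : phi (restrict T C) w ≤ r)
    (h : ∀ᶠ t in 𝓝[>] (0 : ℝ), z.1 + t • (w.1 - z.1) ∈ C) :
    w.2 z.1 + z.2 w.1 - coupling z ≤ r := by
  -- Here `a = c(z)`: the terms of order zero in `t` cancel, and one may divide by `t`.
  have key : ∀ᶠ t in 𝓝[>] (0 : ℝ),
      (1 - t) * (w.2 z.1 + z.2 w.1 - coupling z) + t * coupling w ≤ r := by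
    filter_upwards [hNI.eventually_coupling_segment_le hz hw h, self_mem_nhdsWithin] with t ht ht0
    have ht0 : 0 < t := ht0
    refine le_of_mul_le_mul_left ?_ ht0
    linarith
  refine le_of_tendsto (tendsto_nhdsWithin_of_tendsto_nhds
    (Continuous.tendsto' (by fun_prop) _ _ ?_)) key
  simp

theorem IsTestSet.interior_inter_nonempty (h : IsTestSet T C) :
    (interior C ∩ domain T).Nonempty := by
  rw [inter_comm]; exact h.2.2

variable [IsTopologicalAddGroup X] [ContinuousSMul ℝ X]

theorem eventually_segment_mem_of_isOpen (hV : IsOpen V) {x : X} (hx : x ∈ V) (y : X) :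
    ∀ᶠ t in 𝓝[>] (0 : ℝ), x + t • (y - x) ∈ V := by
  have hc : Tendsto (fun t : ℝ => x + t • (y - x)) (𝓝 0) (𝓝 x) :=
    Continuous.tendsto' (by fun_prop) _ _ (by simp)
  exact tendsto_nhdsWithin_of_tendsto_nhds hc (hV.mem_nhds hx)

theorem IsLocallyNI.isNIOn (h : IsLocallyNI T) (hC : IsTestSet T C)
    (hmon : IsMonotone (restrict T (interior C))) : IsNIOn T C := by
  obtain ⟨-, hCc, u, ⟨y, hy⟩, hu⟩ := hC
  have hNI := h _ isOpen_interior hCc.interior ⟨u, hu, y, hy⟩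
  have hsub := graph_restrict_mono (T := T) (interior_subset (s := C))
  rw [isNIOn_iff]
  intro z hz r hr
  refine hNI.coupling_le_of_eventually ((phi_mono hsub).trans hr)
    (hmon.graph_subset_monRelated (a := (u, y)) ⟨hu, hy⟩) ?_
  filter_upwards [Ioc_mem_nhdsGT (zero_lt_one' ℝ)] with t ht
  exact hCc.add_smul_sub_mem_interior hz hu ht

theorem normalCone_eq_zero {x : X} (hx : x ∈ interior C) {y : WeakDual ℝ X}
    (hy : y ∈ normalCone C x) : y = 0 := by
  have h0 : ∀ v : X, y v ≤ 0 := by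
    intro v
    obtain ⟨t, ht, ht0⟩ := ((eventually_segment_mem_of_isOpen isOpen_interior hx (x + v)).and
      self_mem_nhdsWithin).exists
    have ht0 : 0 < t := ht0
    have := hy.2 _ (interior_subset ht)
    simp only [add_sub_cancel_left, map_smul, smul_eq_mul] at this
    exact nonpos_of_mul_nonpos_right this ht0
  refine ContinuousLinearMap.ext fun v => le_antisymm (h0 v) ?_
  have := h0 (-v)
  rw [map_neg] at this
  exact neg_nonpos.1 this

/-- Over `C` the normal part contributes with a favourable sign, so points monotonically related to
`T|_C` stay related to the sum; over the interior the normal part vanishes. -/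
theorem Identifies.of_opAdd_normalCone (h : Identifies C (opAdd T (normalCone C))) :
    monRelated (restrict T C) ∩ interior C ×ˢ univ ⊆ graph T := by
  rintro z ⟨hz, hzC, -⟩
  have hz' : z ∈ monRelated (restrict (opAdd T (normalCone C)) C) := by
    rw [mem_monRelated_iff] at hz ⊢
    rintro ⟨u, _⟩ ⟨huC, a, ha, b, hb, rfl⟩
    have h1 := hz (u, a) ⟨huC, ha⟩
    have h2 := hb.2 z.1 (interior_subset hzC)
    simp only [map_sub, weakDual_add_apply] at *
    linarith
  obtain ⟨a, ha, b, hb, hab⟩ := h ⟨hz', interior_subset hzC, mem_univ _⟩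
  rw [normalCone_eq_zero hzC hb, add_zero] at hab
  change z.2 ∈ T z.1
  rwa [hab]

variable [LocallyConvexSpace ℝ X]

theorem exists_isTestSet_subset (hV : IsOpen V) (hVc : Convex ℝ V) (hVT : (V ∩ domain T).Nonempty)
    {x : X} (hx : x ∈ V) : ∃ C ⊆ V, IsTestSet T C ∧ x ∈ interior C := by
  obtain ⟨v, hv, hvT⟩ := hVT
  obtain ⟨C, hCV, h1, h2, h3, h4⟩ := exists_isClosed_convex_subset hV hVc hx hv
  exact ⟨C, hCV, ⟨h1, h2, v, hvT, h4⟩, h3⟩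

theorem isLocallyNI_of_isTestSet (h : ∀ C, IsTestSet T C → IsNIOn T C) : IsLocallyNI T := by
  rintro V hV hVc hVT z ⟨hz, -⟩
  obtain ⟨C, hCV, hC, hzC⟩ := exists_isTestSet_subset hV hVc hVT hz
  exact (h C hC ⟨interior_subset hzC, mem_univ _⟩).trans (phi_mono (graph_restrict_mono hCV))

/-- Conditions on `[φ_{T|_V} ≤ c]` over all open convex sets `V` can be tested on the interiors of
closed convex sets. -/
theorem forall_open_iff_forall_isTestSet {R : Set (X × WeakDual ℝ X)} :
    (∀ V : Set X, IsOpen V → Convex ℝ V → (V ∩ domain T).Nonempty →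
      monRelated (restrict T V) ∩ V ×ˢ univ ⊆ R) ↔
    ∀ C, IsTestSet T C → monRelated (restrict T C) ∩ interior C ×ˢ univ ⊆ R := by
  constructor
  · rintro h C hC z ⟨hz, hzC⟩
    exact h _ isOpen_interior hC.2.1.interior hC.interior_inter_nonempty
      ⟨monRelated_anti (graph_restrict_mono interior_subset) hz, hzC⟩
  · rintro h V hV hVc hVT z ⟨hz, hzV, -⟩
    obtain ⟨C, hCV, hC, hzC⟩ := exists_isTestSet_subset hV hVc hVT hzV
    exact h C hC ⟨monRelated_anti (graph_restrict_mono hCV) hz, hzC, mem_univ _⟩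

theorem isLocatable_iff : IsLocatable T ↔ ∀ C, IsTestSet T C →
    monRelated (restrict T C) ∩ interior C ×ˢ univ ⊆ domain T ×ˢ univ :=
  forall_open_iff_forall_isTestSet

theorem isIdentifiable_iff : IsIdentifiable T ↔ ∀ C, IsTestSet T C →
    monRelated (restrict T C) ∩ interior C ×ˢ univ ⊆ graph T :=
  forall_open_iff_forall_isTestSet

theorem isLocatable_of_isTestSet (h : ∀ C, IsTestSet T C → Locates C T) : IsLocatable T :=
  isLocatable_iff.2 fun C hC _ hz => h C hC ⟨hz.1, interior_subset hz.2.1, mem_univ _⟩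

end Basic

/-! ### Representability, conjugates, and the sum rule. -/

section Representation

variable {X : Type*} [AddCommGroup X] [Module ℝ X] [TopologicalSpace X]
  {T S : X → Set (WeakDual ℝ X)} {V W C : Set X} {z w : X × WeakDual ℝ X}

/-- The dual of `X × X*` with the topology `τ × ω*` is `X* × X`. -/
theorem exists_pairing_eq (l : (X × WeakDual ℝ X) →L[ℝ] ℝ) :
    ∃ w : X × WeakDual ℝ X, ∀ v, l v = w.2 v.1 + v.2 w.1 := by
  obtain ⟨p, hp⟩ := LinearMap.dualEmbedding_surjective (B := topDualPairing ℝ X)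
    (l.comp (ContinuousLinearMap.inr ℝ X (WeakDual ℝ X)))
  refine ⟨(p, l.comp (ContinuousLinearMap.inl ℝ X (WeakDual ℝ X))), fun v => ?_⟩
  have h1 : l (0, v.2) = v.2 p := (congrArg (fun F => F v.2) hp).symm
  have h2 : v = (v.1, 0) + (0, v.2) := by simp
  conv_lhs => rw [h2, map_add, h1]
  rfl

theorem IsRepresentable.graph_nonempty (h : IsRepresentable T) : (graph T).Nonempty := by
  obtain ⟨⟨x, -, y, hy⟩, -⟩ := h
  exact ⟨(x, y), hy⟩

/-- Midpoint convexity of `h`, together with `c ≤ h`, between two points where `h = c`, is the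
monotonicity inequality. -/
theorem IsRepresentable.isMonotone (hT : IsRepresentable T) : IsMonotone T := by
  obtain ⟨-, h, ⟨-, hconv, -, hc⟩, heq⟩ := hT
  rw [restrict_univ] at heq
  intro z hz w hw
  have hz' : h z = coupling z := (heq.symm.subset hz).1
  have hw' : h w = coupling w := (heq.symm.subset hw).1
  have hmid : h ((1 / 2 : ℝ) • z + (1 / 2 : ℝ) • w) ≤
      ((1 / 2 : ℝ) • coupling z + (1 / 2 : ℝ) • coupling w : ℝ) :=
    hconv (x := (z, coupling z)) hz'.le (y := (w, coupling w)) hw'.le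
      (by norm_num : (0 : ℝ) ≤ 1 / 2) (by norm_num : (0 : ℝ) ≤ 1 / 2) (by norm_num)
  have := EReal.coe_le_coe_iff.1 ((hc _).trans hmid)
  simp [coupling] at this
  simp only [weakDual_sub_apply, map_sub]
  linarith

theorem convex_epi_phi : IsConvexFun (phi T) := by
  intro p hp q hq a b ha hb hab
  change phi T _ ≤ _ at hp
  change phi T _ ≤ _ at hq
  change phi T _ ≤ ((a • p + b • q).2 : ℝ)
  rw [phi_le_iff] at *
  intro w hw
  have e1 := mul_le_mul_of_nonneg_left (hp w hw) ha
  have e2 := mul_le_mul_of_nonneg_left (hq w hw) hb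
  obtain rfl : b = 1 - a := by linarith
  simp
  linarith

theorem continuous_coupling_sub (w : X × WeakDual ℝ X) :
    Continuous fun z : X × WeakDual ℝ X => w.2 z.1 + z.2 w.1 - w.2 w.1 :=
  (((map_continuous (w.2 : X →L[ℝ] ℝ)).comp continuous_fst).add
    ((WeakDual.eval_continuous w.1).comp continuous_snd)).sub continuous_const

theorem lowerSemicontinuous_phi : LowerSemicontinuous (phi T) :=
  lowerSemicontinuous_biSup fun w _ =>
    (continuous_coe_real_ereal.comp (continuous_coupling_sub w)).lowerSemicontinuous

theorem isClosed_epi {E : Type*} [TopologicalSpace E] {h : E → EReal}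
    (hh : LowerSemicontinuous h) : IsClosed (epi h) :=
  hh.isClosed_epigraph.preimage
    (continuous_fst.prodMk (continuous_coe_real_ereal.comp continuous_snd))

theorem IsIdentifiable.mem_graph (hI : IsIdentifiable T) (hT : (graph T).Nonempty)
    (hz : z ∈ monRelated T) : z ∈ graph T := by
  obtain ⟨w, hw⟩ := hT
  refine hI univ isOpen_univ convex_univ ⟨w.1, mem_univ _, w.2, hw⟩ ⟨?_, mem_univ _, mem_univ _⟩
  rwa [restrict_univ]

/-- The representative is `φ_T`: a point with `φ_T < c` would belong to the graph, where `c ≤ φ_T`.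
-/
theorem IsIdentifiable.isRepresentable (hI : IsIdentifiable T) (hT : IsNonvoidMonotone T) :
    IsRepresentable T := by
  obtain ⟨⟨w, hw⟩, hmon⟩ := hT
  have hc : ∀ z, (coupling z : EReal) ≤ phi T z := by
    intro z
    by_contra hlt
    exact hlt (coupling_le_phi_of_mem (hI.mem_graph ⟨w, hw⟩ (mem_monRelated.2 (not_le.1 hlt).le)))
  refine ⟨⟨w.1, mem_univ _, w.2, hw⟩, phi T, ⟨⟨⟨w, ?_⟩, fun z hz => ?_⟩, convex_epi_phi,
    lowerSemicontinuous_phi, hc⟩, ?_⟩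
  · exact (mem_monRelated.1 (hmon.graph_subset_monRelated hw)).trans_lt (EReal.coe_lt_top _)
  · exact absurd ((hc z).trans hz.le) (not_le.2 (EReal.bot_lt_coe _))
  · rw [restrict_univ]
    ext z
    constructor
    · rintro ⟨hz, -⟩
      exact hI.mem_graph ⟨w, hw⟩ (mem_monRelated.2 (le_of_eq hz))
    · intro hz
      exact ⟨le_antisymm (hmon.graph_subset_monRelated hz) (hc z), mem_univ _, mem_univ _⟩

theorem IsIdentifiable.isLocallyNI (hI : IsIdentifiable T) : IsLocallyNI T :=
  fun V hV hVc hVT => (hI V hV hVc hVT).locates.isNIOn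

variable [IsTopologicalAddGroup X] [ContinuousSMul ℝ X]

/-- The subdifferential sum rule for `φ_{T|_C} + ι_{C × X*}`. -/
theorem exists_subgradient_add_normal (hC : IsTestSet T C) (hmon : IsMonotone (restrict T C))
    (hzC : z.1 ∈ C)
    (hsup : ∀ w : X × WeakDual ℝ X, w.1 ∈ C → ∀ r : ℝ, phi (restrict T C) w ≤ r →
      w.2 z.1 + z.2 w.1 - coupling z ≤ r) :
    ∃ n : X →L[ℝ] ℝ, ∀ (w : X × WeakDual ℝ X) (r : ℝ), phi (restrict T C) w ≤ r →
      w.2 z.1 + z.2 w.1 - coupling z + (n z.1 - n w.1) ≤ r := by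
  obtain ⟨-, hCc, u, ⟨y, hy⟩, hu⟩ := hC
  -- `A` is the epigraph of `φ_{T|_C}` minus the tangent of `c` at `z`. By `hsup` it misses the open
  -- strip below zero over `int C`.
  set A : Set ((X × WeakDual ℝ X) × ℝ) :=
    {p | phi (restrict T C) p.1 ≤ ((p.2 + (p.1.2 z.1 + z.2 p.1.1 - coupling z) : ℝ) : EReal)}
    with hA
  have hAc : Convex ℝ A := by
    intro p hp q hq a b ha hb hab
    rw [hA, mem_ofPred_eq, phi_le_iff] at *
    intro w hw
    have e1 := mul_le_mul_of_nonneg_left (hp w hw) ha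
    have e2 := mul_le_mul_of_nonneg_left (hq w hw) hb
    obtain rfl : b = 1 - a := by linarith
    simp
    linarith
  set B : Set ((X × WeakDual ℝ X) × ℝ) := (interior C ×ˢ univ) ×ˢ Iio 0 with hB
  have hBc : Convex ℝ B := (hCc.interior.prod convex_univ).prod (convex_Iio 0)
  have hBo : IsOpen B := (isOpen_interior.prod isOpen_univ).prod isOpen_Iio
  have hdisj : Disjoint B A := by
    rw [Set.disjoint_left]
    rintro p ⟨⟨hp, -⟩, hp0⟩ hpA
    have h1 := hsup p.1 (interior_subset hp) _ hpA
    have h2 : p.2 < 0 := hp0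
    linarith
  obtain ⟨F, s, hFB, hFA⟩ := geometric_hahn_banach_open hBc hBo hAc hdisj
  set α := F (0, 1) with hα
  have hF : ∀ (x : X) (y : WeakDual ℝ X) (t : ℝ),
      F ((x, y), t) = F ((x, 0), 0) + F ((0, y), 0) + α * t := by
    intro x y t
    have : (((x, y), t) : (X × WeakDual ℝ X) × ℝ) =
      ((x, 0), 0) + ((0, y), 0) + t • ((0, 1) : (X × WeakDual ℝ X) × ℝ) := by
      ext <;> simp
    rw [this, map_add, map_add, map_smul, smul_eq_mul, mul_comm]
  have huA := hFA ((u, y), coupling (u, y) - (y z.1 + z.2 u - coupling z)) (by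
    have := hmon.graph_subset_monRelated (a := (u, y)) ⟨interior_subset hu, hy⟩
    rw [mem_monRelated] at this
    rw [hA, mem_ofPred_eq]
    simpa using this)
  have hαpos : 0 < α := by
    set t₀ := coupling (u, y) - (y z.1 + z.2 u - coupling z)
    have h1 := hFB ((u, y), -(|t₀| + 1)) ⟨⟨hu, mem_univ _⟩, by
      rw [mem_Iio]; linarith [abs_nonneg t₀]⟩
    have h2 := h1.trans_le huA
    rw [hF u y, hF u y t₀] at h2
    have h3 : 0 < α * (t₀ + (|t₀| + 1)) := by linarith
    exact pos_of_mul_pos_left h3 (by linarith [neg_abs_le t₀])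
  have hle : ∀ x ∈ interior C, ∀ y : WeakDual ℝ X, F ((x, 0), 0) + F ((0, y), 0) ≤ s := by
    intro x hx y
    refine le_of_forall_pos_lt_add fun ε hε => ?_
    have := hFB ((x, y), -(ε / α)) ⟨⟨hx, mem_univ _⟩, by
      rw [mem_Iio]; linarith [div_pos hε hαpos]⟩
    rw [hF, mul_neg, mul_div_cancel₀ _ hαpos.ne'] at this
    linarith
  -- `B` is unrestricted in the dual variable, so the bounded functional vanishes in that direction;
  -- only a functional on `X` remains.
  have hzero : ∀ y : WeakDual ℝ X, F ((0, y), 0) = 0 := by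
    have hneg : ∀ y : WeakDual ℝ X, F ((0, y), 0) ≤ 0 := by
      intro y
      by_contra! hpos
      obtain ⟨k, hk⟩ := Archimedean.arch (s - F ((u, 0), 0) + 1) hpos
      have h1 := hle u hu ((k : ℝ) • y)
      have h2 : (((0, (k : ℝ) • y), 0) : (X × WeakDual ℝ X) × ℝ) = (k : ℝ) • ((0, y), 0) := by
        simp
      rw [h2, map_smul, smul_eq_mul, ← nsmul_eq_mul] at h1
      linarith
    intro y
    refine le_antisymm (hneg y) ?_
    have h1 := hneg (-y)
    have h2 : (((0, -y), 0) : (X × WeakDual ℝ X) × ℝ) = -((0, y), 0) := by simp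
    rw [h2, map_neg] at h1
    linarith
  set m : X →L[ℝ] ℝ := (F.comp (ContinuousLinearMap.inl ℝ _ ℝ)).comp
    (ContinuousLinearMap.inl ℝ X (WeakDual ℝ X)) with hm
  have hmF : ∀ x, F ((x, 0), 0) = m x := fun _ => rfl
  have hmz : m z.1 ≤ s := by
    have hcl : z.1 ∈ closure (interior C) := by
      rw [hCc.closure_interior_eq_closure_of_nonempty_interior ⟨u, hu⟩]
      exact subset_closure hzC
    refine closure_minimal (t := {x | m x ≤ s}) (fun x hx => ?_)
      (isClosed_le m.continuous continuous_const) hcl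
    have h1 := hle x hx 0
    rwa [hzero, add_zero, hmF] at h1
  refine ⟨α⁻¹ • m, fun w r hr => ?_⟩
  have h1 := hFA (w, r - (w.2 z.1 + z.2 w.1 - coupling z)) (by
    rw [hA, mem_ofPred_eq]
    simpa using hr)
  rw [show w = (w.1, w.2) from rfl, hF, hzero, hmF] at h1
  have h2 : α⁻¹ * (m z.1 - m w.1) ≤ r - (w.2 z.1 + z.2 w.1 - coupling z) := by
    rw [inv_mul_le_iff₀ hαpos]
    simp only at h1
    linarith
  have h3 : (α⁻¹ • m) z.1 - (α⁻¹ • m) w.1 = α⁻¹ * (m z.1 - m w.1) := by simp; ring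
  rw [h3]
  linarith

/-- Tilting `z` by the functional `n` of the sum rule makes it monotonically related to the whole of
`T`; identification by `X` then gives an image at `z.1`. -/
theorem IsIdentifiable.locates_of_isTestSet (hI : IsIdentifiable T) (hT : IsNonvoidMonotone T)
    (hC : IsTestSet T C) : Locates C T := by
  rintro z ⟨hz, hzC, -⟩
  have hNI := hI.isLocallyNI.isNIOn hC (hT.2.mono graph_restrict_subset)
  obtain ⟨n, hn⟩ := exists_subgradient_add_normal hC (hT.2.mono graph_restrict_subset) hzC
    fun w hw r hr => hNI.le_of_mem_monRelated hz hr
      (eventually_segment_mem_of_convex hC.2.1 hzC hw)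
  let n' : WeakDual ℝ X := n
  refine ⟨⟨z.2 - n', hI.mem_graph (z := (z.1, z.2 - n')) hT.1 ?_⟩, mem_univ _⟩
  rw [mem_monRelated_iff]
  intro w hw
  have h1 := hn w (coupling w)
    ((phi_mono graph_restrict_subset).trans (hT.2.graph_subset_monRelated hw))
  have h2 : ∀ x, n' x = n x := fun _ => rfl
  simp only [coupling, weakDual_sub_apply, h2] at *
  linarith

variable [LocallyConvexSpace ℝ X]

/-- If the conjugate of `φ_S` is at most `c` at `z`, then so is every closed convex function that
is at most `c` on the graph of `S`. -/
theorem coupling_mem_of_conjugate_le {A : Set ((X × WeakDual ℝ X) × ℝ)} (hA : Convex ℝ A)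
    (hA' : IsClosed A) (hS : ∀ v ∈ graph S, (v, coupling v) ∈ A)
    {e : X × WeakDual ℝ X} {t₀ t₁ : ℝ} (he : ∀ t, t₀ ≤ t → (e, t) ∈ A) (he' : (e, t₁) ∉ A)
    (hz : ∀ (w : X × WeakDual ℝ X) (r : ℝ), phi S w ≤ r →
      w.2 z.1 + z.2 w.1 - coupling z ≤ r) : (z, coupling z) ∈ A := by
  by_contra hzA
  have : LocallyConvexSpace ℝ (WeakDual ℝ X) :=
    inferInstanceAs (LocallyConvexSpace ℝ (WeakBilin (topDualPairing ℝ X)))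
  obtain ⟨l, r, h1, h2⟩ := exists_affine_minorant hA hA' he he' hzA
  obtain ⟨w, hw⟩ := exists_pairing_eq l
  -- A minorant `⟨w, ·⟩ - r` lying below `c` on the graph says `φ_S(w) ≤ r`, so `hz` bounds it by
  -- `c(z)` at `z`.
  have h3 := hz w r (phi_le_iff.2 fun v hv => by
    have := h1 _ (hS v hv)
    rw [hw] at this
    simp only [coupling] at this
    linarith)
  rw [hw] at h2
  linarith

theorem IsRepresentative.eq_coupling {h : X × WeakDual ℝ X → EReal} (hh : IsRepresentative h)
    (hS : (graph S).Nonempty) (hSh : ∀ v ∈ graph S, h v = coupling v)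
    (hz : ∀ (w : X × WeakDual ℝ X) (r : ℝ), phi S w ≤ r →
      w.2 z.1 + z.2 w.1 - coupling z ≤ r) : h z = coupling z := by
  obtain ⟨e, he⟩ := hS
  refine le_antisymm ?_ (hh.2.2.2 z)
  refine coupling_mem_of_conjugate_le hh.2.1 (isClosed_epi hh.2.2.1) (S := S)
    (fun v hv => (hSh v hv).le) (e := e) (t₀ := coupling e) (t₁ := coupling e - 1) ?_ ?_ hz
  · exact fun t ht => (hSh e he).le.trans (EReal.coe_le_coe_iff.2 ht)
  · intro hmem
    have := EReal.coe_le_coe_iff.1 ((hSh e he).symm.le.trans hmem)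
    linarith

omit [IsTopologicalAddGroup X] [ContinuousSMul ℝ X] [LocallyConvexSpace ℝ X] in
theorem epi_couplingOn : epi (couplingOn T) = {p | p.1 ∈ graph T ∧ coupling p.1 ≤ p.2} := by
  ext p
  by_cases hp : p.1 ∈ graph T <;> simp [epi, couplingOn, hp]

omit [IsTopologicalAddGroup X] [ContinuousSMul ℝ X] [LocallyConvexSpace ℝ X] in
theorem convexHull_epi_couplingOn_subset (hw : w ∈ monRelated T) :
    convexHull ℝ (epi (couplingOn T)) ⊆ {p | w.2 p.1.1 + p.1.2 w.1 - w.2 w.1 ≤ p.2} := by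
  refine convexHull_min ?_ ?_
  · rw [epi_couplingOn]
    rintro p ⟨hp, hp'⟩
    have := mem_monRelated_iff.1 hw _ hp
    simp only [coupling, mem_ofPred_eq] at *
    linarith
  · intro p hp q hq a b ha hb hab
    rw [mem_ofPred_eq] at *
    have e1 := mul_le_mul_of_nonneg_left hp ha
    have e2 := mul_le_mul_of_nonneg_left hq hb
    obtain rfl : b = 1 - a := by linarith
    simp
    linarith

omit [IsTopologicalAddGroup X] [ContinuousSMul ℝ X] [LocallyConvexSpace ℝ X] in
-- Each affine function in the supremum `φ_T` minorizes `c_T`, and this survives the convex and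
-- closed hulls.
theorem IsMonotone.phi_le_psi (hT : IsMonotone T) : phi T z ≤ psi T z := by
  refine le_iInf₂ fun t ht => ?_
  rw [phi_le_iff]
  intro w hw
  have hcl : IsClosed {p : (X × WeakDual ℝ X) × ℝ | w.2 p.1.1 + p.1.2 w.1 - w.2 w.1 ≤ p.2} :=
    isClosed_le ((continuous_coupling_sub w).comp continuous_fst) continuous_snd
  refine closure_minimal ?_ hcl ht
  intro p hp
  refine EReal.coe_le_coe_iff.1 (le_trans ?_ hp)
  exact le_iInf₂ fun t ht => EReal.coe_le_coe_iff.2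
    (convexHull_epi_couplingOn_subset (hT.graph_subset_monRelated hw) ht)

theorem psi_le_coupling (hT : IsNonvoidMonotone T)
    (hz : ∀ (w : X × WeakDual ℝ X) (r : ℝ), phi T w ≤ r →
      w.2 z.1 + z.2 w.1 - coupling z ≤ r) : psi T z ≤ coupling z := by
  obtain ⟨⟨e, he⟩, hmon⟩ := hT
  have hmem : (z, coupling z) ∈ closure (convexHull ℝ (epi (couplingOn T))) := by
    refine coupling_mem_of_conjugate_le (convex_convexHull ℝ _).closure isClosed_closure (S := T)
      (fun v hv => ?_) (e := e) (t₀ := coupling e) (t₁ := coupling e - 1) (fun t ht => ?_) ?_ hz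
    · exact subset_closure (subset_convexHull ℝ _ (by rw [epi_couplingOn]; exact ⟨hv, le_rfl⟩))
    · exact subset_closure (subset_convexHull ℝ _ (by rw [epi_couplingOn]; exact ⟨he, ht⟩))
    -- The affine minorant attached to `e` takes the value `c(e)` there, so the closed hull contains
    -- no point below `c(e)` over `e`.
    · intro hmem
      have hcl : IsClosed {p : (X × WeakDual ℝ X) × ℝ |
          e.2 p.1.1 + p.1.2 e.1 - e.2 e.1 ≤ p.2} :=
        isClosed_le ((continuous_coupling_sub e).comp continuous_fst) continuous_snd
      have := closure_minimal
        (convexHull_epi_couplingOn_subset (hmon.graph_subset_monRelated he)) hcl hmem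
      simp only [coupling, mem_ofPred_eq] at this
      linarith
  refine iInf₂_le (coupling z) (closure_mono (fun p hp => ?_) hmem :
    (z, coupling z) ∈ closure (epi (convFun (couplingOn T))))
  exact iInf₂_le (f := fun (t : ℝ) (_ : (p.1, t) ∈ convexHull ℝ (epi (couplingOn T))) =>
    (t : EReal)) p.2 hp

theorem IsRepresentable.isIdentifiable (hT : IsRepresentable T) (hL : IsLocatable T) :
    IsIdentifiable T := by
  rintro V hV hVc ⟨u, huV, y, hy⟩ z ⟨hz, hzV, -⟩
  have hNI := (hL V hV hVc ⟨u, huV, y, hy⟩).isNIOn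
  obtain ⟨-, h, hh, heq⟩ := hT
  rw [restrict_univ] at heq
  refine heq.subset ⟨?_, mem_univ _, mem_univ _⟩
  refine hh.eq_coupling (S := restrict T V) ⟨(u, y), huV, hy⟩
    (fun v hv => (heq.symm.subset hv.2).1) fun w r hr => ?_
  exact hNI.le_of_mem_monRelated hz hr (eventually_segment_mem_of_isOpen hV hzV w.1)

end Representation

/-! ### Low-representable operators and the closure of the domain. -/

section LowRepresentable

variable {X : Type*} [AddCommGroup X] [Module ℝ X] [TopologicalSpace X]
  [IsTopologicalAddGroup X] [ContinuousSMul ℝ X] [LocallyConvexSpace ℝ X]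
  {T : X → Set (WeakDual ℝ X)} {V C D : Set X} {z : X × WeakDual ℝ X}

/-- If `x ∉ closure D`, a thin neighbourhood of a suitable segment issued from `x` meets `D` only
on the far side of a hyperplane. -/
theorem exists_open_convex_separated [T2Space X] (hV : IsOpen V) (hVc : Convex ℝ V) {x u : X}
    (hx : x ∈ V) (hxD : x ∉ closure D) (hu : u ∈ V) (huD : u ∈ D) :
    ∃ V' ⊆ V, IsOpen V' ∧ Convex ℝ V' ∧ x ∈ V' ∧ (V' ∩ D).Nonempty ∧
      ∃ n : X →L[ℝ] ℝ, ∃ δ > 0, ∀ v ∈ V' ∩ D, n x + δ ≤ n v := by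
  have hcont : Continuous fun s : ℝ => x + s • (u - x) := by fun_prop
  -- `s` is the first parameter at which the segment from `x` to `u` meets `closure D`.
  obtain ⟨s, ⟨⟨hs0, hs1⟩, hsD⟩, hsmin⟩ := (isCompact_Icc.inter_right
    ((isClosed_closure (s := D)).preimage hcont)).exists_isLeast
    ⟨(1 : ℝ), ⟨zero_le_one, le_rfl⟩, by simpa using subset_closure huD⟩
  have hspos : 0 < s := by
    refine lt_of_le_of_ne hs0 ?_
    rintro rfl
    simp [hxD] at hsD
  have hne : x ≠ u := by
    rintro rfl
    exact hxD (subset_closure huD)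
  obtain ⟨f, hf⟩ := geometric_hahn_banach_point_point hne
  have hfpos : 0 < f (u - x) := by rw [map_sub]; linarith
  set K : Set X := (fun t : ℝ => x + t • (u - x)) '' Icc 0 (s / 2) with hK
  have hKD : K ⊆ (closure D)ᶜ := by
    rintro _ ⟨t, ht, rfl⟩ hmem
    have := hsmin ⟨⟨ht.1, by linarith [ht.2]⟩, hmem⟩
    linarith [ht.2]
  obtain ⟨U₀, hU₀, hKU₀⟩ := compact_open_separated_add_right (isCompact_Icc.image hcont)
    isClosed_closure.isOpen_compl hKD
  -- Points of `D` near the segment have parameter above `s / 2`; the thickening costs less than `s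
  -- / 4` in units of `f (u - x)`, which leaves the gap `s / 4`.
  have hδ : 0 < s / 4 * f (u - x) := by positivity
  have hfU : {e : X | -(s / 4 * f (u - x)) < f e} ∈ 𝓝 (0 : X) :=
    (isOpen_lt continuous_const f.continuous).mem_nhds (by simpa using hδ)
  obtain ⟨U, ⟨hU0, hUo, hUc⟩, hUs⟩ :=
    (LocallyConvexSpace.convex_open_basis_zero ℝ X).mem_iff.1 (inter_mem hU₀ hfU)
  set p := x + s • (u - x) with hp
  have hpV : p ∈ V := hVc.add_smul_sub_mem hx hu ⟨hs0, hs1⟩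
  have hsub : ∀ y ∈ segment ℝ x p, y ∈ segment ℝ x p + U := fun y hy =>
    ⟨y, hy, 0, hU0, by simp⟩
  have ho : IsOpen (V ∩ (segment ℝ x p + U)) := hV.inter hUo.add_left
  refine ⟨V ∩ (segment ℝ x p + U), inter_subset_left, ho,
    hVc.inter ((convex_segment x p).add hUc), ⟨hx, hsub _ (left_mem_segment ℝ x p)⟩,
    mem_closure_iff.1 hsD _ ho ⟨hpV, hsub _ (right_mem_segment ℝ x p)⟩, f,
    s / 4 * f (u - x), hδ, ?_⟩
  rintro v ⟨⟨-, hv⟩, hvD⟩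
  obtain ⟨q, hq, e, he, rfl⟩ := hv
  rw [segment_eq_image'] at hq
  obtain ⟨t, ht, rfl⟩ := hq
  have hq : x + t • (p - x) = x + (t * s) • (u - x) := by
    rw [hp, add_sub_cancel_left, smul_smul]
  simp only [hq] at hvD ⊢
  have hts : s / 2 < t * s := by
    by_contra! hle
    refine hKU₀ (add_mem_add ⟨t * s, ⟨mul_nonneg ht.1 hs0, hle⟩, rfl⟩ (hUs he).1)
      (subset_closure hvD)
  have h1 : -(s / 4 * f (u - x)) < f e := (hUs he).2
  have h2 := mul_le_mul_of_nonneg_right hts.le hfpos.le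
  rw [map_add, map_add, map_smul, smul_eq_mul]
  linarith

/-- Otherwise the domain inside `V'` lies beyond a hyperplane. Moving the graph point `(u, y)` to
`(u, y - k n)` then violates the tangent inequality at `z` by a margin that grows like `k δ`. -/
theorem IsLocallyNI.mem_closure_domain [T2Space X] (hNI : IsLocallyNI T) (hT : IsMonotone T)
    (hV : IsOpen V) (hVc : Convex ℝ V) (hVT : (V ∩ domain T).Nonempty)
    (hz : z ∈ monRelated (restrict T V)) (hzV : z.1 ∈ V) : z.1 ∈ closure (domain T) := by
  by_contra hzD
  obtain ⟨u₀, hu₀V, hu₀⟩ := hVT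
  obtain ⟨V', hV'V, hV', hV'c, hzV', ⟨u, huV, huT⟩, n, δ, hδ, hn⟩ :=
    exists_open_convex_separated hV hVc hzV hzD hu₀V hu₀
  have hNI' := hNI V' hV' hV'c ⟨u, huV, huT⟩
  obtain ⟨y, hy⟩ := huT
  have hz' := monRelated_anti (graph_restrict_mono (T := T) hV'V) hz
  let n' : WeakDual ℝ X := n
  have hn' : ∀ x, n' x = n x := fun _ => rfl
  have key : ∀ k : ℝ, 0 ≤ k → y z.1 + z.2 u - coupling z - y u ≤ -(k * δ) := by
    intro k hk
    have h1 := hNI'.le_of_mem_monRelated (w := (u, y - k • n'))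
      (r := y u - k * (n z.1 + δ)) hz' ?_ (eventually_segment_mem_of_isOpen hV' hzV' u)
    · simp only [weakDual_sub_apply, weakDual_smul_apply, hn'] at h1
      linarith
    · rw [phi_le_iff]
      intro v hv
      have h2 := mem_monRelated_iff.1 (hT.graph_subset_monRelated (a := (u, y)) hy) v hv.2
      have h3 := mul_le_mul_of_nonneg_left (hn v.1 ⟨hv.1, v.2, hv.2⟩) hk
      simp only [weakDual_sub_apply, weakDual_smul_apply, hn'] at *
      linarith
  obtain ⟨k, hk⟩ := Archimedean.arch (-(y z.1 + z.2 u - coupling z - y u) + 1) hδ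
  have := key k k.cast_nonneg
  rw [← nsmul_eq_mul] at this
  linarith

/-- The conjugate bound over `V` and NI over `X` with `φ_T ≤ ψ_T` give `ψ_T(z) = c(z)`, hence a
local representative. Small neighbourhoods of `z.1` meet `D(T)`, so the first-order argument can be
repeated inside one of them. -/
theorem IsLowRepresentable.isIdentifiable [T2Space X] (hLR : IsLowRepresentable T)
    (hT : IsNonvoidMonotone T) (hNI : IsLocallyNI T) : IsIdentifiable T := by
  rintro V hV hVc hVT z ⟨hz, hzV, -⟩
  have hpsi : psi T z = coupling z := by
    refine le_antisymm (psi_le_coupling hT fun w r hr => ?_) ?_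
    · exact (hNI V hV hVc hVT).le_of_mem_monRelated hz
        ((phi_mono graph_restrict_subset).trans hr)
        (eventually_segment_mem_of_isOpen hV hzV w.1)
    · obtain ⟨w, hw⟩ := hT.1
      have h1 := hNI univ isOpen_univ convex_univ ⟨w.1, mem_univ _, w.2, hw⟩
        (show z ∈ univ ×ˢ univ from ⟨mem_univ _, mem_univ _⟩)
      rw [restrict_univ] at h1
      exact le_trans h1 hT.2.phi_le_psi
  have hzD := hNI.mem_closure_domain hT.2 hV hVc hVT hz hzV
  obtain ⟨W, hW, -, h, hh, heq⟩ := hLR z hpsi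
  obtain ⟨V', ⟨hV', hV'c⟩, hV's⟩ :=
    (LocallyConvexSpace.convex_basis (𝕜 := ℝ) z.1).mem_iff.1 (inter_mem hW (hV.mem_nhds hzV))
  have hzi := mem_interior_iff_mem_nhds.2 hV'
  have hsub : interior V' ⊆ W ∩ V := interior_subset.trans hV's
  obtain ⟨u, huV', y, hy⟩ := mem_closure_iff.1 hzD _ isOpen_interior hzi
  have hz' := monRelated_anti (graph_restrict_mono (T := T) (hsub.trans inter_subset_right)) hz
  have hzh : h z = coupling z := by
    refine hh.eq_coupling (S := restrict T (interior V')) ⟨(u, y), huV', hy⟩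
      (fun v hv => (heq.symm.subset ⟨(hsub hv.1).1, hv.2⟩).1) fun w r hr => ?_
    exact (hNI _ isOpen_interior hV'c.interior ⟨u, huV', y, hy⟩).le_of_mem_monRelated hz' hr
      (eventually_segment_mem_of_isOpen isOpen_interior hzi w.1)
  exact (heq.subset ⟨hzh, mem_of_mem_nhds hW, mem_univ _⟩).2

end LowRepresentable

end LCSOperator

theorem theorem3p13 {X : Type*} [AddCommGroup X] [Module ℝ X] [TopologicalSpace X]
    [IsTopologicalAddGroup X] [ContinuousSMul ℝ X] [LocallyConvexSpace ℝ X] [T2Space X]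
    [Nontrivial X] (T : X → Set (WeakDual ℝ X)) :
    -- (i)
    (((∀ C, LCSOperator.IsTestSet T C → LCSOperator.IsNIOn T C) → LCSOperator.IsLocallyNI T) ∧
      (LCSOperator.IsLocallyNI T → ∀ C, LCSOperator.IsTestSet T C →
        LCSOperator.IsMonotone (LCSOperator.restrict T (interior C)) →
          LCSOperator.IsNIOn T C) ∧
      (LCSOperator.IsMonotone T →
        (LCSOperator.IsLocallyNI T ↔
          ∀ C, LCSOperator.IsTestSet T C → LCSOperator.IsNIOn T C))) ∧
    -- (ii)
    ((LCSOperator.IsLocatable T ↔ ∀ C, LCSOperator.IsTestSet T C →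
        LCSOperator.monRelated (LCSOperator.restrict T C) ∩ interior C ×ˢ Set.univ ⊆
          LCSOperator.domain T ×ˢ Set.univ) ∧
      ((∀ C, LCSOperator.IsTestSet T C → LCSOperator.Locates C T) →
        LCSOperator.IsLocatable T)) ∧
    -- (iii)
    ((LCSOperator.IsIdentifiable T ↔ ∀ C, LCSOperator.IsTestSet T C →
        LCSOperator.monRelated (LCSOperator.restrict T C) ∩ interior C ×ˢ Set.univ ⊆
          LCSOperator.graph T) ∧
      ((∀ C, LCSOperator.IsTestSet T C →
          LCSOperator.Identifies C (LCSOperator.opAdd T (LCSOperator.normalCone C))) →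
        LCSOperator.IsIdentifiable T)) ∧
    -- (iv)
    ((LCSOperator.IsNonvoidMonotone T ∧ LCSOperator.IsIdentifiable T ↔
        LCSOperator.IsRepresentable T ∧
          ∀ C, LCSOperator.IsTestSet T C → LCSOperator.Locates C T) ∧
      (LCSOperator.IsNonvoidMonotone T ∧ LCSOperator.IsIdentifiable T ↔
        LCSOperator.IsNonvoidMonotone T ∧ LCSOperator.IsLowRepresentable T ∧
          ∀ C, LCSOperator.IsTestSet T C → LCSOperator.IsNIOn T C)) := by
  open LCSOperator in
  refine ⟨⟨isLocallyNI_of_isTestSet, fun h C hC hmon => h.isNIOn hC hmon, fun hT =>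
    ⟨fun h C hC => h.isNIOn hC (hT.mono graph_restrict_subset), isLocallyNI_of_isTestSet⟩⟩,
    ⟨isLocatable_iff, isLocatable_of_isTestSet⟩,
    ⟨isIdentifiable_iff, fun h => isIdentifiable_iff.2 fun C hC => (h C hC).of_opAdd_normalCone⟩,
    ⟨?_, ?_⟩, ⟨?_, ?_⟩⟩
  · rintro ⟨hT, hI⟩
    exact ⟨hI.isRepresentable hT, fun C hC => hI.locates_of_isTestSet hT hC⟩
  · rintro ⟨hR, hL⟩
    exact ⟨⟨hR.graph_nonempty, hR.isMonotone⟩, hR.isIdentifiable (isLocatable_of_isTestSet hL)⟩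
  · rintro ⟨hT, hI⟩
    exact ⟨hT, fun _ _ => ⟨Set.univ, Filter.univ_mem, hI.isRepresentable hT⟩, fun C hC =>
      hI.isLocallyNI.isNIOn hC (hT.2.mono graph_restrict_subset)⟩
  · rintro ⟨hT, hLR, hNI⟩
    exact ⟨hT, hLR.isIdentifiable hT (isLocallyNI_of_isTestSet hNI)⟩
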